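/- Let $P$ be a regular dodecahedron in $\mathbb{R}^3$ with edge length $a>0$. A \emph{geodesic} joining vertices $V$ and $W$ of $P$ (possibly $V=W$) is a polygonal line of positive length on the surface of $P$ from $V$ to $W$ which meets no vertex in between, is straight in every face, and goes straight across every edge that it crosses (it becomes a straight segment when the faces that it traverses are unfolded into a plane). At time $0$ a wave leaves a vertex $S$ along the surface with unit speed in all directions, and whenever a wave comes to a vertex, a new wave leaves that vertex in the same way. Thus a wave arrives at the vertex $A$ at time $\tau$ if and only if $\tau=\ell_1+\dots+\ell_k$ with $k\ge 1$, where $\ell_i$ is the length of a geodesic from $V_{i-1}$ to $V_i$ for some vertices $S=V_0,V_1,\dots,V_k=A$ of $P$; waves that arrive at the same vertex at the same time are counted once. Let $N_S(t)$ be the number of waves that arrive at the vertices of $P$ up to the time $t$, i.e. the number of such pairs $(A,\tau)$ with $\tau\le t$. Then there is a constant $c$ (depending only on $a$) such that for every vertex $S$ and every $t\ge 0$ the number $N_S(t)$ is finite and $$N_S(t)<\exp\left(c\,t^{5/6}\right).$$ -/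

import Mathlib

namespace Dodecahedron

/-- Euclidean three-space. -/
abbrev E3 : Type := EuclideanSpace ℝ (Fin 3)

/-- The vertices of the regular dodecahedron of edge length `a` centred at the origin: the classical
twenty points `(±1, ±1, ±1)`, `(0, ±1/φ, ±φ)`, `(±φ, 0, ±1/φ)`, `(±1/φ, ±φ, 0)`, which span a
regular dodecahedron of edge length `2/φ`, scaled by `a φ / 2`. Indices are taken modulo three. -/
def vertices (a : ℝ) : Set E3 :=
  {v | ∃ x : E3, v = (a * Real.goldenRatio / 2) • x ∧
    ((∀ i, |x i| = 1) ∨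
      ∃ i, x i = 0 ∧ |x (i + 1)| = Real.goldenRatio⁻¹ ∧ |x (i + 2)| = Real.goldenRatio)}

/-- The outward normals of the twelve faces: `(0, ±φ, ±1)`, `(±1, 0, ±φ)`, `(±φ, ±1, 0)`. -/
def faceNormals : Set E3 :=
  {n | ∃ i, n i = 0 ∧ |n (i + 1)| = Real.goldenRatio ∧ |n (i + 2)| = 1}

/-- The (closed, pentagonal) face with outward normal `n`: the convex hull of the vertices that are
extremal in the direction `n`. -/
def face (a : ℝ) (n : E3) : Set E3 :=
  convexHull ℝ {v | v ∈ vertices a ∧ ∀ w ∈ vertices a, inner ℝ n w ≤ inner ℝ n v}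

/-- The polygonal line runs from `p` to `r` through the point `q` of an edge, straight across that
edge: there is an edge `[x, y]` common to the two distinct faces with normals `m` and `n`, the point
`q` lies in its relative interior, and the vertical angles at `q` agree, so that `p`, `q`, `r` are
successive points of a straight line once the two faces are unfolded about the edge into a plane. -/
def CrossesEdge (a : ℝ) (m n p q r : E3) : Prop :=
  m ≠ n ∧ ∃ x ∈ vertices a, ∃ y ∈ vertices a, dist x y = a ∧
    x ∈ face a m ∧ y ∈ face a m ∧ x ∈ face a n ∧ y ∈ face a n ∧
    q ∈ openSegment ℝ x y ∧
    EuclideanGeometry.angle p q x = EuclideanGeometry.angle r q y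

/-- `IsGeodesic a V W ℓ`: there is a geodesic of length `ℓ` on the surface of the dodecahedron that
starts at the vertex `V`, ends at the vertex `W`, and has no vertex in between. It consists of
`k + 1` straight segments `[p i, p (i + 1)]`, the `i`-th one in the face with normal `n i`, and
goes straight across the `k` edges that it meets on its way. -/
def IsGeodesic (a : ℝ) (V W : E3) (ℓ : ℝ) : Prop :=
  V ∈ vertices a ∧ W ∈ vertices a ∧
  ∃ (k : ℕ) (p n : ℕ → E3),
    p 0 = V ∧ p (k + 1) = W ∧
    (∀ i ≤ k, n i ∈ faceNormals ∧ p i ∈ face a (n i) ∧ p (i + 1) ∈ face a (n i) ∧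
      p i ≠ p (i + 1)) ∧
    (∀ i < k, CrossesEdge a (n i) (n (i + 1)) (p i) (p (i + 1)) (p (i + 2))) ∧
    ℓ = ∑ i ∈ Finset.range (k + 1), dist (p i) (p (i + 1))

/-- `Arrives a S A τ`: a wave arrives at the vertex `A` at the time `τ`, when at the time `0` a wave
leaves the vertex `S`, waves run along geodesics with unit speed, and each arrival at a vertex
starts a new wave there. Equivalently, `τ` is the length of a broken geodesic from `S` to `A`. -/
inductive Arrives (a : ℝ) (S : E3) : E3 → ℝ → Prop
  | direct {A : E3} {ℓ : ℝ} : IsGeodesic a S A ℓ → Arrives a S A ℓ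
  | next {B A : E3} {τ ℓ : ℝ} : Arrives a S B τ → IsGeodesic a B A ℓ → Arrives a S A (τ + ℓ)

/-- The waves that arrive at the vertices up to the time `t`; a wave is recorded by the vertex at
which it arrives and the time of its arrival. -/
def waves (a : ℝ) (S : E3) (t : ℝ) : Set (E3 × ℝ) :=
  {w | Arrives a S w.1 w.2 ∧ w.2 ≤ t}

end Dodecahedron

/-! Geodesic lengths are sparse enough that their inverse fifth powers have a finite sum; the bound
then follows from a partition-type generating function.

Sparsity comes from Galois conjugation. Scale the dodecahedron so that its vertices have coordinates
in ℤ[√5]. Unfold a geodesic by reflecting the solid, at each crossed edge, in the plane through that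
edge orthogonal to the direction of its midpoint. The linear part of this mirror map is a symmetry
of the dodecahedron and its translation part is a sum of two vertices, so the unfolded geodesic is a
vector z over ℤ[√5] (`exists_unfolding`, `IsGeodesic.exists_norm_emb`). The same reflections act on
the conjugate figure (√5 ↦ -√5). A Lipschitz map that is affine on edges (`conjMap`) carries the
geodesic along, so the conjugate of z has length O(ℓ). Hence q = z·z, which is ℓ² up to a fixed
factor, has both conjugates O(ℓ²), and so both integer coordinates O(ℓ²)
(`IsGeodesic.exists_zsqrtd`). Since q determines ℓ, comparison with a lattice sum over ℤ² bounds ∑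
ℓ⁻⁵ (`exists_sum_inv_pow_le`).

An arrival time is the sum of a multiset of lengths. Thus ∑ exp(-sτ) is at most ∏ 1/(1 - exp(-sℓ)),
which is exp(O(s⁻⁵)) (`sum_exp_neg_le`). Taking s = t^(-1/6) gives exp(O(t^(5/6))) arrival times
(`card_sums_le`); the twenty vertices only change the constant. -/

namespace Dodecahedron

/-! ### The dodecahedron over ℤ[√5]: finite checks -/

/-- The dot product of two vectors over `ℤ[√5]`. -/
def dot (u w : Fin 3 → ℤ√5) : ℤ√5 := u 0 * w 0 + u 1 * w 1 + u 2 * w 2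

/-- The twenty vertices, scaled so that all coordinates lie in `ℤ[√5]`. -/
def intVertex : Fin 20 → Fin 3 → ℤ√5 :=
  ![![2, 2, 2], ![2, 2, -2], ![2, -2, 2], ![2, -2, -2],
    ![-2, 2, 2], ![-2, 2, -2], ![-2, -2, 2], ![-2, -2, -2],
    ![0, ⟨-1, 1⟩, ⟨1, 1⟩], ![0, ⟨-1, 1⟩, ⟨-1, -1⟩], ![0, ⟨1, -1⟩, ⟨1, 1⟩], ![0, ⟨1, -1⟩, ⟨-1, -1⟩],
    ![⟨1, 1⟩, 0, ⟨-1, 1⟩], ![⟨-1, -1⟩, 0, ⟨-1, 1⟩], ![⟨1, 1⟩, 0, ⟨1, -1⟩], ![⟨-1, -1⟩, 0, ⟨1, -1⟩],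
    ![⟨-1, 1⟩, ⟨1, 1⟩, 0], ![⟨-1, 1⟩, ⟨-1, -1⟩, 0], ![⟨1, -1⟩, ⟨1, 1⟩, 0], ![⟨1, -1⟩, ⟨-1, -1⟩, 0]]

/-- The twelve face normals, scaled so that all coordinates lie in `ℤ[√5]`. -/
def intNormal : Fin 12 → Fin 3 → ℤ√5 :=
  ![![0, ⟨1, 1⟩, 2], ![0, ⟨1, 1⟩, -2], ![0, ⟨-1, -1⟩, 2], ![0, ⟨-1, -1⟩, -2],
    ![2, 0, ⟨1, 1⟩], ![-2, 0, ⟨1, 1⟩], ![2, 0, ⟨-1, -1⟩], ![-2, 0, ⟨-1, -1⟩],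
    ![⟨1, 1⟩, 2, 0], ![⟨1, 1⟩, -2, 0], ![⟨-1, -1⟩, 2, 0], ![⟨-1, -1⟩, -2, 0]]

/-- The two vertices are joined by an edge. -/
def IsEdge (i j : Fin 20) : Prop :=
  dot (intVertex i - intVertex j) (intVertex i - intVertex j) = ⟨24, -8⟩

instance (i j : Fin 20) : Decidable (IsEdge i j) := inferInstanceAs (Decidable (_ = _))

theorem sq_dist_intVertex_cases : ∀ i j, i ≠ j → IsEdge i j ∨
    dot (intVertex i - intVertex j) (intVertex i - intVertex j) ∈
      [(⟨16, 0⟩ : ℤ√5), ⟨32, 0⟩, ⟨24, 8⟩, ⟨48, 0⟩] := by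
  decide +kernel

theorem not_isEdge_of_isEdge_of_isEdge : ∀ i j, IsEdge i j → ∀ k, IsEdge i k → ¬ IsEdge j k := by
  decide +kernel

theorem dot_add_self_of_isEdge : ∀ i j, IsEdge i j →
    dot (intVertex i + intVertex j) (intVertex i + intVertex j) = ⟨24, 8⟩ := by
  decide +kernel

/-- The reflection formula is multiplied through by |c|² = 24 + 8√5, where c is the sum of the ends
of the edge. This keeps it inside ℤ[√5], so one finite check serves both real embeddings. -/
theorem exists_intVertex_reflection : ∀ i j, IsEdge i j → ∀ k, ∃ l, ∀ x,
    (⟨24, 8⟩ : ℤ√5) * intVertex l x = ⟨24, 8⟩ * intVertex k x -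
      2 * dot (intVertex i + intVertex j) (intVertex k) * (intVertex i + intVertex j) x := by
  decide +kernel

theorem dot_intNormal_intVertex_cases : ∀ m k, dot (intNormal m) (intVertex k) ∈
    [(⟨6, 2⟩ : ℤ√5), ⟨-6, -2⟩, ⟨-2, 2⟩, ⟨2, -2⟩] := by
  decide +kernel

theorem exists_dot_intNormal_intVertex : ∀ m, ∃ k, dot (intNormal m) (intVertex k) = ⟨6, 2⟩ := by
  decide +kernel

/-- This identifies the mirror of an edge, defined by its ends, with the one that exchanges the two
adjacent face planes. -/
theorem intVertex_add_eq_intNormal_add : ∀ i j, IsEdge i j →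
    ∀ m, dot (intNormal m) (intVertex i) = ⟨6, 2⟩ → dot (intNormal m) (intVertex j) = ⟨6, 2⟩ →
    ∀ n, dot (intNormal n) (intVertex i) = ⟨6, 2⟩ → dot (intNormal n) (intVertex j) = ⟨6, 2⟩ →
    m ≠ n → intVertex i + intVertex j = intNormal m + intNormal n := by
  decide +kernel

theorem dot_intNormal_self : ∀ m, dot (intNormal m) (intNormal m) = ⟨10, 2⟩ := by
  decide +kernel


/-! ### The two real embeddings -/

/-- The embedding of `ℤ[√5]` into the reals that sends `√5` to the given root of five. -/
noncomputable def rootHom (r : ℝ) (hr : r * r = 5) : ℤ√5 →+* ℝ :=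
  Zsqrtd.lift ⟨r, by simpa using hr⟩

/-- The standard embedding of `ℤ[√5]` into the reals. -/
noncomputable def stdHom : ℤ√5 →+* ℝ := rootHom (√5) (by norm_num)

/-- The conjugate embedding of `ℤ[√5]` into the reals. -/
noncomputable def conjHom : ℤ√5 →+* ℝ := rootHom (-√5) (by norm_num)

theorem stdHom_apply (z : ℤ√5) : stdHom z = z.re + z.im * √5 := by
  simp [stdHom, rootHom]

theorem conjHom_apply (z : ℤ√5) : conjHom z = z.re - z.im * √5 := by
  simp [conjHom, rootHom, sub_eq_add_neg]

/-- The vector of Euclidean space with the coordinates `f (u i)`. -/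
noncomputable def emb (f : ℤ√5 →+* ℝ) (u : Fin 3 → ℤ√5) : E3 := WithLp.toLp 2 fun i => f (u i)

@[simp] theorem emb_apply (f : ℤ√5 →+* ℝ) (u : Fin 3 → ℤ√5) (i : Fin 3) :
    emb f u i = f (u i) := rfl

theorem emb_add (f : ℤ√5 →+* ℝ) (u w : Fin 3 → ℤ√5) : emb f (u + w) = emb f u + emb f w := by
  ext i; simp

theorem emb_sub (f : ℤ√5 →+* ℝ) (u w : Fin 3 → ℤ√5) : emb f (u - w) = emb f u - emb f w := by
  ext i; simp

theorem emb_zero (f : ℤ√5 →+* ℝ) : emb f 0 = 0 := by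
  ext i; simp

theorem inner_emb (f : ℤ√5 →+* ℝ) (u w : Fin 3 → ℤ√5) :
    inner ℝ (emb f u) (emb f w) = f (dot u w) := by
  simp [dot, PiLp.inner_apply, Fin.sum_univ_three, mul_comm]

theorem norm_emb_sq (f : ℤ√5 →+* ℝ) (u : Fin 3 → ℤ√5) : ‖emb f u‖ ^ 2 = f (dot u u) := by
  rw [← real_inner_self_eq_norm_sq, inner_emb]

theorem lt_sqrt_five : (2.2 : ℝ) < √5 := by
  apply Real.lt_sqrt_of_sq_lt; norm_num

theorem sqrt_five_lt : √5 < (2.3 : ℝ) := by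
  rw [Real.sqrt_lt' (by norm_num)]; norm_num

/-! ### Edge reflections acting on the dodecahedron and its conjugate -/

/-- Reflection in the plane through the origin orthogonal to `c`. -/
noncomputable def planeReflection (c : E3) : E3 ≃ₗᵢ[ℝ] E3 := (ℝ ∙ c)ᗮ.reflection

theorem planeReflection_apply (c v : E3) :
    planeReflection c v = v - (2 * inner ℝ c v / ‖c‖ ^ 2) • c := by
  rw [planeReflection, Submodule.reflection_orthogonal_apply, Submodule.reflection_singleton_apply]
  simp only [RCLike.ofReal_real_eq_id, id]
  module

theorem planeReflection_eq_self {c v : E3} (h : inner ℝ c v = 0) : planeReflection c v = v := by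
  simp [planeReflection_apply, h]

theorem planeReflection_emb {f : ℤ√5 →+* ℝ} (hf : f ⟨24, 8⟩ ≠ 0) {c u w : Fin 3 → ℤ√5}
    (hc : dot c c = ⟨24, 8⟩)
    (h : ∀ x, (⟨24, 8⟩ : ℤ√5) * w x = ⟨24, 8⟩ * u x - 2 * dot c u * c x) :
    planeReflection (emb f c) (emb f u) = emb f w := by
  rw [planeReflection_apply, norm_emb_sq, inner_emb, hc]
  ext x
  have := congrArg f (h x)
  simp only [map_mul, map_sub, map_ofNat] at this
  simp only [PiLp.sub_apply, PiLp.smul_apply, emb_apply, smul_eq_mul]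
  field_simp
  linarith

theorem stdHom_ne_zero : stdHom ⟨24, 8⟩ ≠ 0 := by
  rw [stdHom_apply]; push_cast; have := lt_sqrt_five; intro h; linarith

theorem conjHom_ne_zero : conjHom ⟨24, 8⟩ ≠ 0 := by
  rw [conjHom_apply]; push_cast; have := sqrt_five_lt; intro h; linarith

/-- A vertex of the dodecahedron of scale one, as a point of space. -/
noncomputable def stdVertex (i : Fin 20) : E3 := emb stdHom (intVertex i)

/-- The Galois conjugate of a vertex of the dodecahedron. -/
noncomputable def conjVertex (i : Fin 20) : E3 := emb conjHom (intVertex i)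

/-- A pair of isometries which permute the vertices and the conjugate vertices in the same way. -/
def Compatible (H H' : E3 ≃ₗᵢ[ℝ] E3) : Prop :=
  ∀ i, ∃ j, H (stdVertex i) = stdVertex j ∧ H' (conjVertex i) = conjVertex j

theorem compatible_refl : Compatible (LinearIsometryEquiv.refl ℝ E3) (LinearIsometryEquiv.refl ℝ E3) :=
  fun i => ⟨i, rfl, rfl⟩

theorem Compatible.trans {H H' G G' : E3 ≃ₗᵢ[ℝ] E3} (h : Compatible H H') (g : Compatible G G') :
    Compatible (H.trans G) (H'.trans G') := by
  intro i
  obtain ⟨j, h1, h2⟩ := h i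
  obtain ⟨k, g1, g2⟩ := g j
  exact ⟨k, by simp [h1, g1], by simp [h2, g2]⟩

theorem compatible_planeReflection {i j : Fin 20} (h : IsEdge i j) :
    Compatible (planeReflection (stdVertex i + stdVertex j))
      (planeReflection (conjVertex i + conjVertex j)) := by
  intro k
  obtain ⟨l, hl⟩ := exists_intVertex_reflection i j h k
  have hc := dot_add_self_of_isEdge i j h
  refine ⟨l, ?_, ?_⟩
  · rw [stdVertex, stdVertex, ← emb_add]
    exact planeReflection_emb stdHom_ne_zero hc hl
  · rw [conjVertex, conjVertex, ← emb_add]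
    exact planeReflection_emb conjHom_ne_zero hc hl

theorem dot_self_intVertex : ∀ i, dot (intVertex i) (intVertex i) = ⟨12, 0⟩ := by
  decide +kernel

theorem norm_emb_intVertex_sq (f : ℤ√5 →+* ℝ) (i : Fin 20) : ‖emb f (intVertex i)‖ ^ 2 = 12 := by
  rw [norm_emb_sq, dot_self_intVertex]
  exact map_ofNat f 12

theorem inner_add_sub_emb (f : ℤ√5 →+* ℝ) (i j : Fin 20) :
    inner ℝ (emb f (intVertex i) + emb f (intVertex j))
      (emb f (intVertex i) - emb f (intVertex j)) = 0 := by
  have := real_inner_add_sub_eq_zero_iff (emb f (intVertex i)) (emb f (intVertex j))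
  rw [this, ← abs_norm, ← abs_norm (emb f (intVertex j)), ← sq_eq_sq_iff_abs_eq_abs,
    norm_emb_intVertex_sq, norm_emb_intVertex_sq]

/-- The half-turn about an edge midpoint followed by the point reflection in it fixes the edge. -/
theorem add_planeReflection_lineMap {x y : E3} (h : inner ℝ (x + y) (x - y) = 0)
    (h0 : x + y ≠ 0) (r t : ℝ) :
    r • (x + y) + planeReflection (x + y) (r • ((1 - t) • x + t • y)) =
      r • ((1 - t) • x + t • y) := by
  have hn : ‖x + y‖ ^ 2 ≠ 0 := by positivity
  -- Split into a part along the mirror normal `x + y`, which the translation restores, and a part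
  -- along the edge, which the reflection fixes.
  have h2 : r • ((1 - t) • x + t • y) = (r / 2) • (x + y) + (r * (1 / 2 - t)) • (x - y) := by
    module
  rw [planeReflection_apply, h2, inner_add_right, inner_smul_right, inner_smul_right, h,
    real_inner_self_eq_norm_sq]
  have h3 : 2 * (r / 2 * ‖x + y‖ ^ 2 + r * (1 / 2 - t) * 0) / ‖x + y‖ ^ 2 = r := by
    field_simp; ring
  rw [h3]; module

/-! ### Distances between vertices and edges -/

theorem norm_sub_sq_stdVertex (i j : Fin 20) : ‖stdVertex i - stdVertex j‖ ^ 2 =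
    stdHom (dot (intVertex i - intVertex j) (intVertex i - intVertex j)) := by
  rw [stdVertex, stdVertex, ← emb_sub, norm_emb_sq]

theorem norm_sub_sq_of_isEdge {i j : Fin 20} (h : IsEdge i j) :
    ‖stdVertex i - stdVertex j‖ ^ 2 = 24 - 8 * √5 := by
  rw [norm_sub_sq_stdVertex, h, stdHom_apply]; push_cast; ring

theorem norm_sub_sq_of_not_isEdge {i j : Fin 20} (hne : i ≠ j) (h : ¬ IsEdge i j) :
    2 * (24 - 8 * √5) ≤ ‖stdVertex i - stdVertex j‖ ^ 2 := by
  rw [norm_sub_sq_stdVertex]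
  have h1 := lt_sqrt_five
  have := (sq_dist_intVertex_cases i j hne).resolve_left h
  simp only [List.mem_cons, List.not_mem_nil, or_false] at this
  rcases this with h | h | h | h <;> rw [h, stdHom_apply] <;> push_cast <;> linarith

theorem norm_sub_sq_ge {i j : Fin 20} (hne : i ≠ j) :
    24 - 8 * √5 ≤ ‖stdVertex i - stdVertex j‖ ^ 2 := by
  by_cases h : IsEdge i j
  · rw [norm_sub_sq_of_isEdge h]
  · have := norm_sub_sq_of_not_isEdge hne h
    have := sqrt_five_lt
    linarith

theorem isEdge_of_norm_sub_sq {i j : Fin 20} (h : ‖stdVertex i - stdVertex j‖ ^ 2 = 24 - 8 * √5) :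
    IsEdge i j := by
  have h1 := sqrt_five_lt
  by_contra hn
  have hne : i ≠ j := by
    rintro rfl
    simp at h; linarith
  have := norm_sub_sq_of_not_isEdge hne hn
  linarith

/-- Stewart's theorem. -/
theorem norm_lineMap_sub_sq (x y v : E3) (t : ℝ) : ‖(1 - t) • x + t • y - v‖ ^ 2 =
    (1 - t) * ‖x - v‖ ^ 2 + t * ‖y - v‖ ^ 2 - t * (1 - t) * ‖x - y‖ ^ 2 := by
  have h1 : (1 - t) • x + t • y - v = (1 - t) • (x - v) + t • (y - v) := by module
  have h2 : x - y = (x - v) - (y - v) := by abel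
  rw [h1, h2, norm_add_sq_real, norm_sub_sq_real (x - v) (y - v), norm_smul, norm_smul, mul_pow, mul_pow,
    inner_smul_left, inner_smul_right, Real.norm_eq_abs, Real.norm_eq_abs, sq_abs, sq_abs]
  simp only [conj_trivial]
  ring

/-- A point of an edge is no closer than the edge length to the vertices off the edge. -/
theorem norm_lineMap_sub_sq_ge {i j k : Fin 20} (h : IsEdge i j) (hi : i ≠ k) (hj : j ≠ k) {t : ℝ}
    (h0 : 0 ≤ t) (h1 : t ≤ 1) :
    24 - 8 * √5 ≤ ‖(1 - t) • stdVertex i + t • stdVertex j - stdVertex k‖ ^ 2 := by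
  have h5 := sqrt_five_lt
  rw [norm_lineMap_sub_sq, norm_sub_sq_of_isEdge h]
  have d1 := norm_sub_sq_ge hi
  have d2 := norm_sub_sq_ge hj
  set e := 24 - 8 * √5
  have he : 0 < e := by simp only [e]; linarith
  -- No three vertices are pairwise adjacent, so at least one end of the edge has squared distance
  -- at least 2e from vertex `k`. Stewart's identity then gives at least e(1 + t²) or e(1 + (1 -
  -- t)²).
  by_cases hik : IsEdge i k
  · have d3 := norm_sub_sq_of_not_isEdge hj (not_isEdge_of_isEdge_of_isEdge i j h k hik)
    nlinarith [mul_nonneg h0 (sub_nonneg.2 d3), mul_nonneg (sub_nonneg.2 h1) (sub_nonneg.2 d1),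
      mul_nonneg he.le (sq_nonneg t)]
  · have d3 := norm_sub_sq_of_not_isEdge hi hik
    nlinarith [mul_nonneg h0 (sub_nonneg.2 d2), mul_nonneg (sub_nonneg.2 h1) (sub_nonneg.2 d3),
      mul_nonneg he.le (sq_nonneg (1 - t))]


/-! ### Comparison of the integral model with the given dodecahedron -/

/-- The factor by which the integral model has to be scaled to get edge length `a`. -/
noncomputable def scale (a : ℝ) : ℝ := a * Real.goldenRatio / 4

theorem scale_pos {a : ℝ} (ha : 0 < a) : 0 < scale a := by
  have := Real.goldenRatio_pos
  unfold scale; positivity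

theorem scale_sq_mul (a : ℝ) : scale a ^ 2 * (24 - 8 * √5) = a ^ 2 := by
  have h : √5 ^ 2 = 5 := Real.sq_sqrt (by norm_num)
  have h2 : (1 + √5) ^ 2 * (24 - 8 * √5) = 64 := by
    linear_combination (8 - 8 * √5) * h
  unfold scale Real.goldenRatio
  linear_combination (a ^ 2 / 64) * h2

theorem exists_intVertex_eq_of_two : ∀ a ∈ [(2 : ℤ√5), -2], ∀ b ∈ [(2 : ℤ√5), -2],
    ∀ c ∈ [(2 : ℤ√5), -2], ∃ k, intVertex k = ![a, b, c] := by
  decide +kernel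

theorem exists_intVertex_eq_of_zero : ∀ i : Fin 3, ∀ b ∈ [(⟨-1, 1⟩ : ℤ√5), -⟨-1, 1⟩],
    ∀ c ∈ [(⟨1, 1⟩ : ℤ√5), -⟨1, 1⟩], ∃ k, intVertex k i = 0 ∧ intVertex k (i + 1) = b ∧
      intVertex k (i + 2) = c := by
  decide +kernel

theorem exists_intNormal_eq : ∀ i : Fin 3, ∀ b ∈ [(⟨1, 1⟩ : ℤ√5), -⟨1, 1⟩],
    ∀ c ∈ [(2 : ℤ√5), -2], ∃ k, intNormal k i = 0 ∧ intNormal k (i + 1) = b ∧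
      intNormal k (i + 2) = c := by
  decide +kernel

theorem intVertex_shape : ∀ k, (∀ i, intVertex k i ∈ [(2 : ℤ√5), -2]) ∨
    ∃ i : Fin 3, intVertex k i = 0 ∧ intVertex k (i + 1) ∈ [(⟨-1, 1⟩ : ℤ√5), -⟨-1, 1⟩] ∧
      intVertex k (i + 2) ∈ [(⟨1, 1⟩ : ℤ√5), -⟨1, 1⟩] := by
  decide +kernel

/-- A number whose absolute value is half the positive number `stdHom z`. -/
theorem abs_eq_half_iff {x : ℝ} {z : ℤ√5} (hz : 0 ≤ stdHom z) :
    |x| = stdHom z / 2 ↔ ∃ w ∈ [z, -z], x = stdHom w / 2 := by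
  rw [abs_eq (by positivity)]
  simp [neg_div]

theorem stdHom_two : stdHom 2 = 2 := map_ofNat _ _

theorem stdHom_goldenRatio : stdHom ⟨1, 1⟩ / 2 = Real.goldenRatio := by
  rw [stdHom_apply]; push_cast; ring

theorem stdHom_inv_goldenRatio : stdHom ⟨-1, 1⟩ / 2 = Real.goldenRatio⁻¹ := by
  rw [stdHom_apply, Real.inv_goldenRatio]; unfold Real.goldenConj; push_cast; ring

theorem eq_of_coordinates {x y : E3} (i : Fin 3) (h0 : x i = y i) (h1 : x (i + 1) = y (i + 1))
    (h2 : x (i + 2) = y (i + 2)) : x = y := by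
  ext j
  fin_cases i <;> fin_cases j <;> first | exact h0 | exact h1 | exact h2

theorem mem_vertices_iff {a : ℝ} {v : E3} :
    v ∈ vertices a ↔ ∃ k, v = scale a • stdVertex k := by
  have g2 : (0 : ℝ) ≤ stdHom 2 := by rw [stdHom_two]; norm_num
  have g1 : (0 : ℝ) ≤ stdHom ⟨1, 1⟩ := by
    have := Real.goldenRatio_pos; rw [← stdHom_goldenRatio] at this; linarith
  have g3 : (0 : ℝ) ≤ stdHom ⟨-1, 1⟩ := by
    have := inv_pos.2 Real.goldenRatio_pos; rw [← stdHom_inv_goldenRatio] at this; linarith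
  have e2 : (1 : ℝ) = stdHom 2 / 2 := by rw [stdHom_two]; norm_num
  have hs : scale a = a * Real.goldenRatio / 2 * (1 / 2) := by unfold scale; ring
  constructor
  · rintro ⟨x, rfl, h | ⟨i, h0, h1, h2⟩⟩
    · simp only [e2, abs_eq_half_iff g2] at h
      choose w hw hx using h
      obtain ⟨k, hk⟩ := exists_intVertex_eq_of_two _ (hw 0) _ (hw 1) _ (hw 2)
      refine ⟨k, ?_⟩
      rw [hs, mul_smul]
      congr 1
      ext j
      rw [hx, PiLp.smul_apply, stdVertex, emb_apply, hk, smul_eq_mul, div_eq_inv_mul, one_div]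
      fin_cases j <;> rfl
    · rw [← stdHom_goldenRatio, abs_eq_half_iff g1] at h2
      rw [← stdHom_inv_goldenRatio, abs_eq_half_iff g3] at h1
      obtain ⟨b, hb, h1⟩ := h1
      obtain ⟨c, hc, h2⟩ := h2
      obtain ⟨k, k0, k1, k2⟩ := exists_intVertex_eq_of_zero i b hb c hc
      refine ⟨k, ?_⟩
      rw [hs, mul_smul]
      congr 1
      apply eq_of_coordinates i
      · simp [h0, stdVertex, k0]
      · simp [h1, stdVertex, k1]; ring
      · simp [h2, stdVertex, k2]; ring
  · rintro ⟨k, rfl⟩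
    refine ⟨(1 / 2 : ℝ) • stdVertex k, by rw [hs, mul_smul], ?_⟩
    have hx : ∀ j, ((1 / 2 : ℝ) • stdVertex k) j = stdHom (intVertex k j) / 2 := by
      intro j; simp [stdVertex]; ring
    simp only [hx]
    rcases intVertex_shape k with h | ⟨i, h0, h1, h2⟩
    · left
      intro i
      rw [e2, abs_eq_half_iff g2]
      exact ⟨_, h i, rfl⟩
    · right
      refine ⟨i, by rw [h0]; simp, ?_, ?_⟩
      · rw [← stdHom_inv_goldenRatio, abs_eq_half_iff g3]; exact ⟨_, h1, rfl⟩
      · rw [← stdHom_goldenRatio, abs_eq_half_iff g1]; exact ⟨_, h2, rfl⟩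

/-- Twice a face normal. -/
noncomputable def stdNormal (m : Fin 12) : E3 := emb stdHom (intNormal m)

theorem exists_eq_stdNormal {n : E3} (hn : n ∈ faceNormals) :
    ∃ m, n = (1 / 2 : ℝ) • stdNormal m := by
  obtain ⟨i, h0, h1, h2⟩ := hn
  have e2 : (1 : ℝ) = stdHom 2 / 2 := by rw [stdHom_two]; norm_num
  rw [e2, abs_eq_half_iff (by rw [stdHom_two]; norm_num)] at h2
  rw [← stdHom_goldenRatio, abs_eq_half_iff] at h1
  · obtain ⟨b, hb, h1⟩ := h1
    obtain ⟨c, hc, h2⟩ := h2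
    obtain ⟨k, k0, k1, k2⟩ := exists_intNormal_eq i b hb c hc
    refine ⟨k, ?_⟩
    apply eq_of_coordinates i
    · simp [h0, stdNormal, k0]
    · simp [h1, stdNormal, k1]; ring
    · simp [h2, stdNormal, k2]; ring
  · have := Real.goldenRatio_pos; rw [← stdHom_goldenRatio] at this; linarith

theorem inner_stdNormal_stdVertex_le (m : Fin 12) (k : Fin 20) :
    inner ℝ (stdNormal m) (stdVertex k) ≤ stdHom ⟨6, 2⟩ := by
  have h5 := lt_sqrt_five
  rw [stdNormal, stdVertex, inner_emb]
  have := dot_intNormal_intVertex_cases m k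
  simp only [List.mem_cons, List.not_mem_nil, or_false] at this
  rcases this with h | h | h | h <;> rw [h] <;> simp only [stdHom_apply] <;> push_cast <;> linarith

/-- Since 5 is not a square, real equalities of inner products can be pulled back to ℤ[√5], where
the finite checks apply. -/
theorem stdHom_injective : Function.Injective stdHom := by
  apply Zsqrtd.lift_injective
  intro n hn
  have h1 : n.natAbs ≤ 2 ∨ 3 ≤ n.natAbs := by omega
  have h2 : n.natAbs * n.natAbs = 5 := by
    zify; rw [Int.abs_eq_natAbs] ; rw [Int.natAbs_mul_self']; exact hn.symm
  rcases h1 with h | h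
  · interval_cases n.natAbs <;> omega
  · nlinarith

/-- The extremal vertices of a face are those with the maximal inner product. -/
theorem dot_eq_of_extremal {a : ℝ} (ha : 0 < a) {m : Fin 12} {k : Fin 20}
    (h : ∀ w ∈ vertices a, inner ℝ ((1 / 2 : ℝ) • stdNormal m) w ≤
      inner ℝ ((1 / 2 : ℝ) • stdNormal m) (scale a • stdVertex k)) :
    dot (intNormal m) (intVertex k) = ⟨6, 2⟩ := by
  have hs := scale_pos ha
  obtain ⟨l, hl⟩ := exists_dot_intNormal_intVertex m
  have h1 := h _ (mem_vertices_iff.2 ⟨l, rfl⟩)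
  simp only [inner_smul_left, inner_smul_right, conj_trivial] at h1
  have h2 : inner ℝ (stdNormal m) (stdVertex l) ≤ inner ℝ (stdNormal m) (stdVertex k) :=
    le_of_mul_le_mul_left (le_of_mul_le_mul_left h1 hs) (by norm_num)
  have h3 := inner_stdNormal_stdVertex_le m k
  rw [stdNormal, stdVertex, inner_emb] at h3
  rw [stdNormal, stdVertex, stdVertex, inner_emb, inner_emb, hl] at h2
  exact stdHom_injective (le_antisymm h3 h2)

theorem inner_eq_of_mem_face {a : ℝ} (ha : 0 < a) {m : Fin 12} {p : E3}
    (hp : p ∈ face a ((1 / 2 : ℝ) • stdNormal m)) :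
    inner ℝ (stdNormal m) p = scale a * stdHom ⟨6, 2⟩ := by
  have hc : Convex ℝ {q : E3 | inner ℝ (stdNormal m) q = scale a * stdHom ⟨6, 2⟩} :=
    convex_hyperplane (f := fun q => inner ℝ (stdNormal m) q)
      ⟨fun x y => inner_add_right _ _ _, fun c x => inner_smul_right _ _ _⟩ _
  refine convexHull_min ?_ hc hp
  rintro v ⟨hv, h⟩
  obtain ⟨k, rfl⟩ := mem_vertices_iff.1 hv
  have := dot_eq_of_extremal ha h
  change inner ℝ _ _ = _
  rw [inner_smul_right, stdNormal, stdVertex, inner_emb, this]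

theorem inner_le_of_mem_face {a : ℝ} (ha : 0 < a) (m : Fin 12) {n p : E3} (hp : p ∈ face a n) :
    inner ℝ (stdNormal m) p ≤ scale a * stdHom ⟨6, 2⟩ := by
  have hc : Convex ℝ {q : E3 | inner ℝ (stdNormal m) q ≤ scale a * stdHom ⟨6, 2⟩} :=
    convex_halfSpace_le (f := fun q => inner ℝ (stdNormal m) q)
      ⟨fun x y => inner_add_right _ _ _, fun c x => inner_smul_right _ _ _⟩ _
  refine convexHull_min ?_ hc hp
  rintro v ⟨hv, -⟩
  obtain ⟨k, rfl⟩ := mem_vertices_iff.1 hv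
  change inner ℝ _ _ ≤ _
  rw [inner_smul_right]
  exact mul_le_mul_of_nonneg_left (inner_stdNormal_stdVertex_le m k) (scale_pos ha).le

theorem norm_scale_smul_sub_sq (a : ℝ) (x y : E3) :
    ‖scale a • x - scale a • y‖ ^ 2 = scale a ^ 2 * ‖x - y‖ ^ 2 := by
  rw [← smul_sub, norm_smul, mul_pow, Real.norm_eq_abs, sq_abs]

theorem isEdge_of_dist_eq {a : ℝ} (ha : 0 < a) {i j : Fin 20}
    (h : dist (scale a • stdVertex i) (scale a • stdVertex j) = a) : IsEdge i j := by
  apply isEdge_of_norm_sub_sq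
  rw [dist_eq_norm] at h
  have h1 := norm_scale_smul_sub_sq a (stdVertex i) (stdVertex j)
  rw [h, ← scale_sq_mul] at h1
  exact (mul_left_cancel₀ (pow_pos (scale_pos ha) 2).ne' h1).symm

/-- The normals of the two faces at an edge add up to the sum of the two ends of the edge. -/
theorem stdNormal_add_stdNormal {a : ℝ} (ha : 0 < a) {m n : Fin 12} {i j : Fin 20} (hmn : m ≠ n)
    (hij : IsEdge i j)
    (him : scale a • stdVertex i ∈ face a ((1 / 2 : ℝ) • stdNormal m))
    (hjm : scale a • stdVertex j ∈ face a ((1 / 2 : ℝ) • stdNormal m))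
    (hin : scale a • stdVertex i ∈ face a ((1 / 2 : ℝ) • stdNormal n))
    (hjn : scale a • stdVertex j ∈ face a ((1 / 2 : ℝ) • stdNormal n)) :
    stdVertex i + stdVertex j = stdNormal m + stdNormal n := by
  have key : ∀ (m : Fin 12) (i : Fin 20),
      scale a • stdVertex i ∈ face a ((1 / 2 : ℝ) • stdNormal m) →
      dot (intNormal m) (intVertex i) = ⟨6, 2⟩ := by
    intro m i h
    have := inner_eq_of_mem_face ha h
    rw [inner_smul_right, stdNormal, stdVertex, inner_emb] at this
    exact stdHom_injective (mul_left_cancel₀ (scale_pos ha).ne' this)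
  have := intVertex_add_eq_intNormal_add i j hij m (key m i him) (key m j hjm) n (key n i hin)
    (key n j hjn) hmn
  rw [stdVertex, stdVertex, stdNormal, stdNormal, ← emb_add, ← emb_add, this]

theorem norm_stdNormal_sq (m : Fin 12) : ‖stdNormal m‖ ^ 2 = stdHom ⟨10, 2⟩ := by
  rw [stdNormal, norm_emb_sq, dot_intNormal_self]

/-! ### Unfolding across one edge -/

/-- Otherwise the remainder would be a fourth nonzero vector orthogonal to `m`, `e`, `g` in
three-space. -/
theorem eq_smul_add_smul_of_orthogonal {m e g n : E3} (hm : m ≠ 0) (he : e ≠ 0) (hg : g ≠ 0)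
    (hme : inner ℝ m e = 0) (hmg : inner ℝ m g = 0) (heg : inner ℝ e g = 0)
    (hne : inner ℝ n e = 0) :
    n = (inner ℝ m n / ‖m‖ ^ 2) • m + (inner ℝ g n / ‖g‖ ^ 2) • g := by
  by_contra hcon
  set h := n - ((inner ℝ m n / ‖m‖ ^ 2) • m + (inner ℝ g n / ‖g‖ ^ 2) • g) with hh
  have h0 : h ≠ 0 := sub_ne_zero.2 hcon
  have hm2 : ‖m‖ ^ 2 ≠ 0 := by positivity
  have hg2 : ‖g‖ ^ 2 ≠ 0 := by positivity
  have hgm : inner ℝ g m = 0 := by rw [real_inner_comm, hmg]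
  have hem : inner ℝ e m = 0 := by rw [real_inner_comm, hme]
  have hge : inner ℝ g e = 0 := by rw [real_inner_comm, heg]
  have hen : inner ℝ e n = 0 := by rw [real_inner_comm, hne]
  have h1 : inner ℝ m h = 0 := by
    simp only [hh, inner_sub_right, inner_add_right, inner_smul_right, hmg,
      real_inner_self_eq_norm_sq]
    field_simp; ring
  have h2 : inner ℝ e h = 0 := by
    simp [hh, inner_sub_right, inner_add_right, inner_smul_right, hem, heg, hen]
  have h3 : inner ℝ g h = 0 := by
    simp only [hh, inner_sub_right, inner_add_right, inner_smul_right, hgm,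
      real_inner_self_eq_norm_sq]
    field_simp; ring
  have hli : LinearIndependent ℝ ![m, e, g, h] := by
    apply linearIndependent_of_ne_zero_of_inner_eq_zero (𝕜 := ℝ)
    · intro i; fin_cases i
      exacts [hm, he, hg, h0]
    · intro i j hij
      fin_cases i <;> fin_cases j <;>
        first
        | exact absurd rfl hij
        | assumption
        | (simp; done)
        | (change inner ℝ _ _ = 0; rw [real_inner_comm]; assumption)
  have := hli.fintype_card_le_finrank
  simp at this

/-- A line that meets an edge at the same angle on both of its sides becomes straight when the one
face is turned into the plane of the other; unit vectors. -/
theorem planeReflection_eq_neg_of_norm_eq_one {m n e u w : E3} (hnorm : ‖m‖ = ‖n‖) (hmn : m ≠ n)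
    (hmn' : m + n ≠ 0) (he : e ≠ 0) (hme : inner ℝ m e = 0) (hne : inner ℝ n e = 0)
    (hu : ‖u‖ = 1) (hw : ‖w‖ = 1) (hmu : inner ℝ m u = 0) (hnu : inner ℝ n u ≤ 0)
    (hnw : inner ℝ n w = 0) (hmw : inner ℝ m w ≤ 0) (heu : inner ℝ e u = -inner ℝ e w) :
    planeReflection (m + n) w = -u := by
  have hRm : planeReflection (m + n) m = -n := by
    have h1 : ‖m + n‖ ^ 2 ≠ 0 := by positivity
    have h2 : 2 * inner ℝ (m + n) m / ‖m + n‖ ^ 2 = 1 := by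
      rw [div_eq_one_iff_eq h1, norm_add_sq_real, inner_add_left, real_inner_self_eq_norm_sq,
        real_inner_comm n m, ← hnorm]
      ring
    rw [planeReflection_apply, h2]; module
  have hRn : planeReflection (m + n) n = -m := by
    have h1 : ‖m + n‖ ^ 2 ≠ 0 := by positivity
    have h2 : 2 * inner ℝ (m + n) n / ‖m + n‖ ^ 2 = 1 := by
      rw [div_eq_one_iff_eq h1, norm_add_sq_real, inner_add_left, real_inner_self_eq_norm_sq,
        ← hnorm]
      ring
    rw [planeReflection_apply, h2]; module
  have hRe : planeReflection (m + n) e = e :=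
    planeReflection_eq_self (by rw [inner_add_left, hme, hne, add_zero])
  set R := planeReflection (m + n)
  have hRR : ∀ x y, inner ℝ (R x) (R y) = inner ℝ x y := fun x y => R.inner_map_map x y
  have h1 : inner ℝ m (R w) = 0 := by
    have := hRR n w; rw [hRn, hnw, inner_neg_left] at this; linarith
  have h2 : 0 ≤ inner ℝ n (R w) := by
    have := hRR m w; rw [hRm, inner_neg_left] at this; linarith
  have h3 : inner ℝ e (R w) = inner ℝ e w := by
    have := hRR e w; rwa [hRe] at this
  have h4 : ‖R w‖ = 1 := by rw [R.norm_map, hw]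
  -- Both u and -Rw are unit vectors orthogonal to m with the same component along e, so their
  -- difference g is orthogonal to m and e. If g ≠ 0, then n = αm + γg. The products of n with u and
  -- with Rw are equal but have opposite weak signs, which forces γ = 0 and n = ±m.
  by_contra hcon
  set g := u + R w with hg
  have hg0 : g ≠ 0 := fun h => hcon (eq_neg_of_add_eq_zero_right h)
  have hm0 : m ≠ 0 := by
    rintro rfl
    rw [norm_zero, eq_comm, norm_eq_zero] at hnorm
    exact hmn hnorm.symm
  have hgu : 0 < inner ℝ g u ∧ inner ℝ g (R w) = inner ℝ g u := by
    have e1 : ‖g‖ ^ 2 = 2 * inner ℝ g u := by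
      rw [hg, norm_add_sq_real, inner_add_left, real_inner_self_eq_norm_sq, hu, h4,
        real_inner_comm u (R w)]
      ring
    have e2 : inner ℝ g (R w) = inner ℝ g u := by
      rw [hg, inner_add_left, inner_add_left, real_inner_self_eq_norm_sq,
        real_inner_self_eq_norm_sq, hu, h4, real_inner_comm u (R w)]
      ring
    have : 0 < ‖g‖ ^ 2 := by positivity
    exact ⟨by linarith, e2⟩
  have hdec := eq_smul_add_smul_of_orthogonal hm0 he hg0 hme
    (by rw [hg, inner_add_right, hmu, h1, add_zero])
    (by rw [hg, inner_add_right, heu, h3]; ring) hne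
  set γ := inner ℝ g n / ‖g‖ ^ 2
  set α := inner ℝ m n / ‖m‖ ^ 2
  have k1 : inner ℝ n u = γ * inner ℝ g u := by
    conv_lhs => rw [hdec]
    simp [inner_add_left, inner_smul_left, hmu]
  have k2 : inner ℝ n (R w) = γ * inner ℝ g u := by
    conv_lhs => rw [hdec]
    simp [inner_add_left, inner_smul_left, h1, hgu.2]
  have k3 : γ * inner ℝ g u = 0 := by linarith
  have k4 : γ = 0 := by
    rcases mul_eq_zero.1 k3 with h | h
    · exact h
    · exact absurd h hgu.1.ne'
  rw [k4, zero_smul, add_zero] at hdec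
  have k5 : |α| = 1 := by
    have := hnorm
    rw [hdec, norm_smul, Real.norm_eq_abs] at this
    have hmp : 0 < ‖m‖ := norm_pos_iff.2 hm0
    exact mul_right_cancel₀ hmp.ne' (by linarith)
  rcases (abs_eq (by norm_num : (0 : ℝ) ≤ 1)).1 k5 with h | h
  · exact hmn (by rw [hdec, h, one_smul])
  · exact hmn' (by rw [hdec, h]; module)

/-- The unit-vector case with denominators cleared. The angles are taken to `e` and `-e` because
vertical angles at a crossing point look towards opposite ends of the edge. -/
theorem norm_smul_planeReflection_eq {m n e u w : E3} (hnorm : ‖m‖ = ‖n‖) (hmn : m ≠ n)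
    (hmn' : m + n ≠ 0) (he : e ≠ 0) (hme : inner ℝ m e = 0) (hne : inner ℝ n e = 0)
    (hu : u ≠ 0) (hw : w ≠ 0) (hmu : inner ℝ m u = 0) (hnu : inner ℝ n u ≤ 0)
    (hnw : inner ℝ n w = 0) (hmw : inner ℝ m w ≤ 0)
    (heu : InnerProductGeometry.angle u e = InnerProductGeometry.angle w (-e)) :
    (‖u‖ : ℝ) • planeReflection (m + n) w = (‖w‖ : ℝ) • -u := by
  have hu' : 0 < ‖u‖ := norm_pos_iff.2 hu
  have hw' : 0 < ‖w‖ := norm_pos_iff.2 hw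
  have he' : 0 < ‖e‖ := norm_pos_iff.2 he
  have hcos := congrArg Real.cos heu
  rw [InnerProductGeometry.cos_angle, InnerProductGeometry.cos_angle, inner_neg_right, norm_neg,
    real_inner_comm, real_inner_comm e w] at hcos
  have key := planeReflection_eq_neg_of_norm_eq_one (u := ‖u‖⁻¹ • u) (w := ‖w‖⁻¹ • w) hnorm hmn
    hmn' he hme hne (by rw [norm_smul]; simp [hu'.ne']) (by rw [norm_smul]; simp [hw'.ne'])
    (by simp [inner_smul_right, hmu])
    (by rw [inner_smul_right]; exact mul_nonpos_of_nonneg_of_nonpos (by positivity) hnu)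
    (by simp [inner_smul_right, hnw])
    (by rw [inner_smul_right]; exact mul_nonpos_of_nonneg_of_nonpos (by positivity) hmw)
    (by
      rw [inner_smul_right, inner_smul_right]
      field_simp at hcos ⊢
      linarith)
  rw [map_smul] at key
  have := congrArg (fun z => (‖u‖ * ‖w‖) • z) key
  simp only [smul_smul, smul_neg] at this
  rw [mul_assoc, mul_inv_cancel₀ hw'.ne', mul_one] at this
  rw [this, smul_neg, mul_comm ‖u‖, mul_assoc, mul_inv_cancel₀ hu'.ne', mul_one]


theorem emb_intVertex_add_ne_zero {f : ℤ√5 →+* ℝ} (hf : f ⟨24, 8⟩ ≠ 0) {i j : Fin 20}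
    (h : IsEdge i j) : emb f (intVertex i) + emb f (intVertex j) ≠ 0 := by
  intro h0
  have := norm_emb_sq f (intVertex i + intVertex j)
  rw [emb_add, h0, dot_add_self_of_isEdge i j h, norm_zero] at this
  exact hf (by rw [← this]; norm_num)

theorem stdVertex_sub_ne_zero {i j : Fin 20} (h : IsEdge i j) :
    stdVertex i - stdVertex j ≠ 0 := by
  intro h0
  have := norm_sub_sq_of_isEdge h
  rw [h0, norm_zero] at this
  have := sqrt_five_lt
  linarith

/-- A polygonal line that goes straight across an edge stays straight when it is unfolded. -/
theorem CrossesEdge.exists_unfolding {a : ℝ} (ha : 0 < a) {m n p q r : E3}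
    (h : CrossesEdge a m n p q r) (hm : m ∈ faceNormals) (hn : n ∈ faceNormals)
    (hp : p ∈ face a m) (hr : r ∈ face a n) (hpq : p ≠ q) (hqr : q ≠ r) :
    ∃ (i j : Fin 20) (t : ℝ), IsEdge i j ∧ 0 ≤ t ∧ t ≤ 1 ∧
      q = scale a • ((1 - t) • stdVertex i + t • stdVertex j) ∧
      dist p q • planeReflection (stdVertex i + stdVertex j) (r - q) = dist q r • (q - p) := by
  obtain ⟨m, rfl⟩ := exists_eq_stdNormal hm
  obtain ⟨n, rfl⟩ := exists_eq_stdNormal hn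
  obtain ⟨hmn, x, hx, y, hy, hxy, hxm, hym, hxn, hyn, hq, hang⟩ := h
  obtain ⟨i, rfl⟩ := mem_vertices_iff.1 hx
  obtain ⟨j, rfl⟩ := mem_vertices_iff.1 hy
  obtain ⟨u, t, hu, ht, hut, rfl⟩ := hq
  obtain rfl : u = 1 - t := by linarith
  have hs := scale_pos ha
  have hij := isEdge_of_dist_eq ha hxy
  have hmn' : m ≠ n := fun h => hmn (by rw [h])
  have hsum := stdNormal_add_stdNormal ha hmn' hij hxm hym hxn hyn
  set q := (1 - t) • scale a • stdVertex i + t • scale a • stdVertex j with hqdef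
  have hmx := inner_eq_of_mem_face ha hxm
  have hmy := inner_eq_of_mem_face ha hym
  have hnx := inner_eq_of_mem_face ha hxn
  have hny := inner_eq_of_mem_face ha hyn
  have hmq : inner ℝ (stdNormal m) q = scale a * stdHom ⟨6, 2⟩ := by
    rw [hqdef, inner_add_right, real_inner_smul_right _ _ (1 - t), real_inner_smul_right _ _ t, hmx, hmy]
    ring
  have hnq : inner ℝ (stdNormal n) q = scale a * stdHom ⟨6, 2⟩ := by
    rw [hqdef, inner_add_right, real_inner_smul_right _ _ (1 - t), real_inner_smul_right _ _ t, hnx, hny]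
    ring
  have hxq : scale a • stdVertex i - q = (t * scale a) • (stdVertex i - stdVertex j) := by
    rw [hqdef]; module
  have hyq : scale a • stdVertex j - q =
      ((1 - t) * scale a) • -(stdVertex i - stdVertex j) := by
    rw [hqdef]; module
  refine ⟨i, j, t, hij, ht.le, by linarith, by rw [hqdef]; module, ?_⟩
  simp only [EuclideanGeometry.angle, vsub_eq_sub] at hang
  rw [hxq, hyq, InnerProductGeometry.angle_smul_right_of_pos _ _ (by positivity),
    InnerProductGeometry.angle_smul_right_of_pos _ _ (by positivity)] at hang
  have hme : ∀ l, inner ℝ (stdNormal l) (scale a • stdVertex i) = scale a * stdHom ⟨6, 2⟩ →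
      inner ℝ (stdNormal l) (scale a • stdVertex j) = scale a * stdHom ⟨6, 2⟩ →
      inner ℝ (stdNormal l) (stdVertex i - stdVertex j) = 0 := by
    intro l h1 h2
    rw [inner_smul_right] at h1 h2
    rw [inner_sub_right, sub_eq_zero]
    exact mul_left_cancel₀ hs.ne' (h1.trans h2.symm)
  have hnorm : ‖stdNormal m‖ = ‖stdNormal n‖ := by
    rw [← abs_norm, ← abs_norm (stdNormal n), ← sq_eq_sq_iff_abs_eq_abs, norm_stdNormal_sq,
      norm_stdNormal_sq]
  have hne : stdNormal m ≠ stdNormal n := fun h => hmn (by rw [h])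
  have key := norm_smul_planeReflection_eq (u := p - q) (w := r - q) hnorm hne
    (by rw [← hsum]; exact emb_intVertex_add_ne_zero stdHom_ne_zero hij)
    (stdVertex_sub_ne_zero hij) (hme m hmx hmy) (hme n hnx hny) (sub_ne_zero.2 hpq)
    (sub_ne_zero.2 hqr.symm)
    (by rw [inner_sub_right, inner_eq_of_mem_face ha hp, hmq, sub_self])
    (by rw [inner_sub_right, hnq, sub_nonpos]; exact inner_le_of_mem_face ha n hp)
    (by rw [inner_sub_right, inner_eq_of_mem_face ha hr, hnq, sub_self])
    (by rw [inner_sub_right, hmq, sub_nonpos]; exact inner_le_of_mem_face ha m hr) hang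
  rw [hsum, dist_eq_norm, dist_comm q r, dist_eq_norm, key, neg_sub]

/-! ### The Lipschitz map to the conjugate figure -/

/-- The map to the conjugate dodecahedron, affine on every edge. -/
noncomputable def conjMap (a : ℝ) (p : E3) : E3 :=
  ∑ k, max 0 (1 - ‖p - scale a • stdVertex k‖ / a) • conjVertex k

/-- A Lipschitz constant for `conjMap`. -/
noncomputable def lipConst (a : ℝ) : ℝ := ∑ k, ‖conjVertex k‖ / a

/-- Each hat function is 1/a-Lipschitz on all of space, so no distance along the surface is needed.
-/
theorem norm_conjMap_sub_le {a : ℝ} (ha : 0 < a) (p q : E3) :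
    ‖conjMap a p - conjMap a q‖ ≤ lipConst a * dist p q := by
  rw [conjMap, conjMap, ← Finset.sum_sub_distrib, lipConst, Finset.sum_mul]
  apply norm_sum_le_of_le
  intro k _
  rw [← sub_smul, norm_smul, Real.norm_eq_abs, max_comm, max_comm (0 : ℝ)]
  have h1 : |max (1 - ‖p - scale a • stdVertex k‖ / a) 0 -
      max (1 - ‖q - scale a • stdVertex k‖ / a) 0| ≤ dist p q / a := by
    refine (abs_max_sub_max_le_abs _ _ _).trans ?_
    have h2 : 1 - ‖p - scale a • stdVertex k‖ / a - (1 - ‖q - scale a • stdVertex k‖ / a) =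
        (‖q - scale a • stdVertex k‖ - ‖p - scale a • stdVertex k‖) / a := by ring
    rw [h2, abs_div, abs_of_pos ha]
    gcongr
    refine (abs_norm_sub_norm_le _ _).trans ?_
    rw [sub_sub_sub_cancel_right, dist_comm, dist_eq_norm]
  calc _ ≤ dist p q / a * ‖conjVertex k‖ := by gcongr
    _ = _ := by ring

theorem exists_isEdge : ∀ i, ∃ j, IsEdge i j := by
  decide +kernel

/-- On an edge only the hats of its two ends survive: every other vertex is at distance at least
`a`. The two surviving hats are the barycentric coordinates. -/
theorem conjMap_lineMap {a : ℝ} (ha : 0 < a) {i j : Fin 20} (hij : IsEdge i j) {t : ℝ}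
    (h0 : 0 ≤ t) (h1 : t ≤ 1) :
    conjMap a (scale a • ((1 - t) • stdVertex i + t • stdVertex j)) =
      (1 - t) • conjVertex i + t • conjVertex j := by
  have hs := scale_pos ha
  have hne : i ≠ j := by rintro rfl; exact stdVertex_sub_ne_zero hij (sub_self _)
  have hd : ‖scale a • (stdVertex i - stdVertex j)‖ = a := by
    rw [← sq_eq_sq₀ (norm_nonneg _) ha.le, norm_smul, mul_pow, norm_sub_sq_of_isEdge hij,
      Real.norm_eq_abs, sq_abs, scale_sq_mul]
  rw [conjMap, ← Finset.sum_subset (Finset.subset_univ {i, j}), Finset.sum_pair hne]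
  · congr 2
    · have : scale a • ((1 - t) • stdVertex i + t • stdVertex j) - scale a • stdVertex i =
          (-t) • scale a • (stdVertex i - stdVertex j) := by module
      rw [this, norm_smul, hd, norm_neg, Real.norm_of_nonneg h0, mul_div_cancel_right₀ _ ha.ne',
        max_eq_right (by linarith)]
    · have : scale a • ((1 - t) • stdVertex i + t • stdVertex j) - scale a • stdVertex j =
          (1 - t) • scale a • (stdVertex i - stdVertex j) := by module
      rw [this, norm_smul, hd, Real.norm_of_nonneg (by linarith), mul_div_cancel_right₀ _ ha.ne',
        max_eq_right (by linarith)]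
      ring
  · intro k _ hk
    simp only [Finset.mem_insert, Finset.mem_singleton, not_or] at hk
    have h2 := norm_lineMap_sub_sq_ge hij (Ne.symm hk.1) (Ne.symm hk.2) h0 h1
    have h3 : a ≤ ‖scale a • ((1 - t) • stdVertex i + t • stdVertex j) - scale a • stdVertex k‖ := by
      rw [← sq_le_sq₀ ha.le (norm_nonneg _), norm_scale_smul_sub_sq, ← scale_sq_mul]
      gcongr
    rw [max_eq_left, zero_smul]
    rw [sub_nonpos, one_le_div ha]
    exact h3

theorem conjMap_vertex {a : ℝ} (ha : 0 < a) (i : Fin 20) :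
    conjMap a (scale a • stdVertex i) = conjVertex i := by
  obtain ⟨j, hj⟩ := exists_isEdge i
  simpa using conjMap_lineMap ha hj le_rfl zero_le_one

/-! ### Unfolding a whole geodesic -/

/-- A geodesic, unfolded into a plane, together with its image on the conjugate dodecahedron. -/
theorem exists_unfolding {a : ℝ} (ha : 0 < a) {k : ℕ} {p n : ℕ → E3}
    (hface : ∀ i ≤ k, n i ∈ faceNormals ∧ p i ∈ face a (n i) ∧ p (i + 1) ∈ face a (n i) ∧
      p i ≠ p (i + 1))
    (hcross : ∀ i < k, CrossesEdge a (n i) (n (i + 1)) (p i) (p (i + 1)) (p (i + 2))) :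
    ∃ d : E3, ‖d‖ = 1 ∧ ∀ j ≤ k, ∃ (H H' : E3 ≃ₗᵢ[ℝ] E3) (b : Fin 3 → ℤ√5), Compatible H H' ∧
      H (p (j + 1) - p j) = dist (p j) (p (j + 1)) • d ∧
      H (p (j + 1)) + scale a • emb stdHom b =
        p 0 + (∑ i ∈ Finset.range (j + 1), dist (p i) (p (i + 1))) • d ∧
      ‖H' (conjMap a (p (j + 1))) + emb conjHom b - conjMap a (p 0)‖ ≤
        lipConst a * ∑ i ∈ Finset.range (j + 1), dist (p i) (p (i + 1)) := by
  have hpos : ∀ i ≤ k, 0 < dist (p i) (p (i + 1)) := fun i hi => dist_pos.2 (hface i hi).2.2.2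
  have h0 := hpos 0 (Nat.zero_le k)
  have hd0 : dist (p 0) (p (0 + 1)) • ((dist (p 0) (p (0 + 1)))⁻¹ • (p (0 + 1) - p 0)) =
      p (0 + 1) - p 0 := by
    rw [smul_smul, mul_inv_cancel₀ h0.ne', one_smul]
  refine ⟨(dist (p 0) (p (0 + 1)))⁻¹ • (p (0 + 1) - p 0), ?_, ?_⟩
  · rw [norm_smul, ← dist_eq_norm, dist_comm (p (0 + 1)), norm_inv, Real.norm_of_nonneg h0.le,
      inv_mul_cancel₀ h0.ne']
  set d := (dist (p 0) (p (0 + 1)))⁻¹ • (p (0 + 1) - p 0)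
  intro j
  induction j with
  | zero =>
    intro _
    refine ⟨.refl ℝ E3, .refl ℝ E3, 0, compatible_refl, ?_, ?_, ?_⟩
    · rw [hd0]; rfl
    · rw [Finset.sum_range_one, hd0, emb_zero]; simp
    · rw [Finset.sum_range_one, emb_zero, dist_comm]
      simpa using norm_conjMap_sub_le ha (p 1) (p 0)
  | succ j ih =>
    intro hj
    obtain ⟨H, H', b, hc, h1, h2, h3⟩ := ih (by omega)
    obtain ⟨hn, hp, -, hpq⟩ := hface j (by omega)
    obtain ⟨hn', -, hr, hqr⟩ := hface (j + 1) hj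
    obtain ⟨i, l, t, hil, ht0, ht1, hq, hR⟩ :=
      (hcross j (by omega)).exists_unfolding ha hn hn' hp hr hpq hqr
    obtain ⟨i', hi1, hi2⟩ := hc i
    obtain ⟨l', hl1, hl2⟩ := hc l
    set R := planeReflection (stdVertex i + stdVertex l)
    set R' := planeReflection (conjVertex i + conjVertex l) with hR'
    -- The crossing point lies on the mirror, so the old and the new unfolding agree there. The same
    -- holds for its image in the conjugate figure, because `conjMap` is affine on the edge.
    have hfix : scale a • (stdVertex i + stdVertex l) + R (p (j + 1)) = p (j + 1) := by
      rw [hq]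
      exact add_planeReflection_lineMap (inner_add_sub_emb _ _ _)
        (emb_intVertex_add_ne_zero stdHom_ne_zero hil) _ _
    have hfix' : conjVertex i + conjVertex l + R' (conjMap a (p (j + 1))) =
        conjMap a (p (j + 1)) := by
      rw [hq, conjMap_lineMap ha hil ht0 ht1, hR']
      have := add_planeReflection_lineMap (inner_add_sub_emb conjHom i l)
        (emb_intVertex_add_ne_zero conjHom_ne_zero hil) 1 t
      rw [one_smul, one_smul] at this
      exact this
    have hstep : H (R (p (j + 1 + 1) - p (j + 1))) =
        dist (p (j + 1)) (p (j + 1 + 1)) • d := by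
      have := congrArg H hR
      rw [map_smul, map_smul, h1, smul_comm] at this
      exact smul_right_injective _ (hpos j (by omega)).ne' this
    have hb : ∀ f, emb f (b + intVertex i' + intVertex l') =
        emb f b + (emb f (intVertex i') + emb f (intVertex l')) := by
      intro f; rw [emb_add, emb_add, add_assoc]
    -- The new unfolding applies the mirror map first and the old unfolding second. The translation
    -- by the two ends is carried by `H` to a sum of two vertices again, so it stays integral.
    refine ⟨R.trans H, R'.trans H', b + intVertex i' + intVertex l',
      (compatible_planeReflection hil).trans hc, hstep, ?_, ?_⟩
    · rw [Finset.sum_range_succ, add_smul, ← add_assoc, ← h2, ← hstep, hb]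
      change H (R _) + scale a • (_ + (stdVertex i' + stdVertex l')) = _
      rw [← hi1, ← hl1]
      have := congrArg H hfix
      rw [map_add, map_smul, map_add] at this
      rw [map_sub R, map_sub H]
      rw [← sub_eq_zero] at this ⊢
      rw [← this]
      module
    · rw [Finset.sum_range_succ, mul_add, hb]
      change ‖H' (R' _) + (_ + (conjVertex i' + conjVertex l')) - _‖ ≤ _
      rw [← hi2, ← hl2]
      have := congrArg H' hfix'
      rw [map_add, map_add] at this
      have heq : H' (R' (conjMap a (p (j + 1 + 1)))) +
          (emb conjHom b + (H' (conjVertex i) + H' (conjVertex l))) - conjMap a (p 0) =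
          (H' (conjMap a (p (j + 1))) + emb conjHom b - conjMap a (p 0)) +
          H' (R' (conjMap a (p (j + 1 + 1)) - conjMap a (p (j + 1)))) := by
        rw [map_sub R', map_sub H', ← this]
        module
      rw [heq]
      refine (norm_add_le _ _).trans (add_le_add h3 ?_)
      rw [LinearIsometryEquiv.norm_map, LinearIsometryEquiv.norm_map, dist_comm]
      exact norm_conjMap_sub_le ha _ _

theorem IsGeodesic.exists_norm_emb {a : ℝ} (ha : 0 < a) {V W : E3} {ℓ : ℝ}
    (h : IsGeodesic a V W ℓ) : 0 < ℓ ∧ ∃ z : Fin 3 → ℤ√5,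
      scale a * ‖emb stdHom z‖ = ℓ ∧ ‖emb conjHom z‖ ≤ lipConst a * ℓ := by
  obtain ⟨hV, hW, k, p, n, rfl, rfl, hface, hcross, rfl⟩ := h
  obtain ⟨d, hd, h⟩ := exists_unfolding ha hface hcross
  obtain ⟨H, H', b, hc, -, h2, h3⟩ := h k le_rfl
  obtain ⟨v, hv⟩ := mem_vertices_iff.1 hV
  obtain ⟨w, hw⟩ := mem_vertices_iff.1 hW
  obtain ⟨w', hw1, hw2⟩ := hc w
  have hpos : 0 < ∑ i ∈ Finset.range (k + 1), dist (p i) (p (i + 1)) := by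
    apply Finset.sum_pos
    · intro i hi
      exact dist_pos.2 (hface i (by simpa [Nat.lt_succ_iff] using hi)).2.2.2
    · simp
  -- The displacement from the start to the unfolded end. Both are vertices, so `conjMap` takes them
  -- to conjugate vertices and the second bound concerns the conjugate of this same vector.
  refine ⟨hpos, intVertex w' + b - intVertex v, ?_, ?_⟩
  · rw [hw, hv, map_smul, hw1] at h2
    have h4 : scale a • emb stdHom (intVertex w' + b - intVertex v) =
        (∑ i ∈ Finset.range (k + 1), dist (p i) (p (i + 1))) • d := by
      rw [emb_sub, emb_add]
      change scale a • (stdVertex w' + _ - stdVertex v) = _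
      rw [← add_sub_cancel_left (scale a • stdVertex v) (_ • d), ← h2]
      module
    have h5 := congrArg norm h4
    rwa [norm_smul, norm_smul, hd, mul_one, Real.norm_of_nonneg (scale_pos ha).le,
      Real.norm_of_nonneg hpos.le] at h5
  · rw [hw, hv, conjMap_vertex ha, conjMap_vertex ha, hw2] at h3
    rwa [emb_sub, emb_add]


theorem IsGeodesic.pos {a : ℝ} (ha : 0 < a) {V W : E3} {ℓ : ℝ} (h : IsGeodesic a V W ℓ) :
    0 < ℓ :=
  (h.exists_norm_emb ha).1

/-- The square of the length of a geodesic is a multiple of an element of `ℤ[√5]` whose coordinates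
it bounds. -/
theorem IsGeodesic.exists_zsqrtd {a : ℝ} (ha : 0 < a) {V W : E3} {ℓ : ℝ}
    (h : IsGeodesic a V W ℓ) : ∃ q : ℤ√5, scale a ^ 2 * stdHom q = ℓ ^ 2 ∧
      |(q.re : ℝ)| ≤ ((scale a ^ 2)⁻¹ + lipConst a ^ 2) * ℓ ^ 2 ∧
      |(q.im : ℝ)| ≤ ((scale a ^ 2)⁻¹ + lipConst a ^ 2) * ℓ ^ 2 := by
  obtain ⟨hpos, z, h1, h2⟩ := h.exists_norm_emb ha
  have hs := scale_pos ha
  have e1 : stdHom (dot z z) = (scale a ^ 2)⁻¹ * ℓ ^ 2 := by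
    rw [← norm_emb_sq, ← h1]; field_simp
  have e2 : conjHom (dot z z) ≤ lipConst a ^ 2 * ℓ ^ 2 := by
    rw [← norm_emb_sq, ← mul_pow]; gcongr
  have e3 : 0 ≤ conjHom (dot z z) := by rw [← norm_emb_sq]; positivity
  refine ⟨dot z z, by rw [e1]; field_simp, ?_⟩
  set q := dot z z
  have h5 := lt_sqrt_five
  have p1 : 0 ≤ (scale a ^ 2)⁻¹ * ℓ ^ 2 := by positivity
  have p2 : 0 ≤ lipConst a ^ 2 * ℓ ^ 2 := by positivity
  rw [← e1] at p1
  rw [add_mul, ← e1]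
  rw [stdHom_apply] at p1 ⊢
  rw [conjHom_apply] at e2 e3
  -- The rational part and the √5-part are half the sum and half the difference of two nonnegative
  -- conjugates, so each is bounded by their sum.
  have him : |(q.im : ℝ)| * √5 ≤ q.re + q.im * √5 + lipConst a ^ 2 * ℓ ^ 2 := by
    rw [← abs_of_pos (by linarith : 0 < √5), ← abs_mul, abs_of_pos (by linarith : 0 < √5), abs_le]
    constructor <;> linarith
  refine ⟨abs_le.2 ⟨by linarith, by linarith⟩, ?_⟩
  nlinarith [abs_nonneg (q.im : ℝ)]

/-! ### Sparsity of the geodesic lengths -/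

/-- The inverse fifth powers of the lengths of geodesics are summable. -/
theorem exists_sum_inv_pow_le {a : ℝ} (ha : 0 < a) : ∃ M : ℝ, ∀ T : Finset ℝ,
    (∀ ℓ ∈ T, ∃ V W, IsGeodesic a V W ℓ) → ∑ ℓ ∈ T, (ℓ ^ 5)⁻¹ ≤ M := by
  have hs := scale_pos ha
  set D := (scale a ^ 2)⁻¹ + lipConst a ^ 2
  have hD : 0 < D := by positivity
  -- The lattice sum over ℤ² converges for exponents above 2. Since the lattice norm is O(ℓ²),
  -- exponent 5/2 corresponds to ℓ⁻⁵.
  have hsum := EisensteinSeries.summable_one_div_norm_rpow (k := 5 / 2) (by norm_num)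
  refine ⟨D ^ (5 / 2 : ℝ) * ∑' x : Fin 2 → ℤ, ‖x‖ ^ (-(5 / 2) : ℝ), fun T hT => ?_⟩
  have hq : ∀ ℓ ∈ T, ∃ q : ℤ√5, 0 < ℓ ∧ scale a ^ 2 * stdHom q = ℓ ^ 2 ∧
      |(q.re : ℝ)| ≤ D * ℓ ^ 2 ∧ |(q.im : ℝ)| ≤ D * ℓ ^ 2 := by
    intro ℓ hℓ
    obtain ⟨V, W, h⟩ := hT ℓ hℓ
    obtain ⟨q, hq⟩ := h.exists_zsqrtd ha
    exact ⟨q, h.pos ha, hq⟩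
  choose! q hpos hq1 hq2 hq3 using hq
  have hinj : Set.InjOn (fun ℓ => ![(q ℓ).re, (q ℓ).im]) T := by
    intro x hx y hy hxy
    have h0 := congrFun hxy 0
    have h1 := congrFun hxy 1
    have h2 : q x = q y := Zsqrtd.ext h0 h1
    have h3 := hq1 x hx
    rw [h2, hq1 y hy] at h3
    exact ((sq_eq_sq₀ (hpos y hy).le (hpos x hx).le).1 h3).symm
  have hterm : ∀ ℓ ∈ T, (ℓ ^ 5)⁻¹ ≤
      D ^ (5 / 2 : ℝ) * ‖![(q ℓ).re, (q ℓ).im]‖ ^ (-(5 / 2) : ℝ) := by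
    intro ℓ hℓ
    have hl := hpos ℓ hℓ
    have hn : ‖![(q ℓ).re, (q ℓ).im]‖ ≤ D * ℓ ^ 2 := by
      rw [pi_norm_le_iff_of_nonneg (by positivity)]
      intro i
      fin_cases i
      · simpa [Int.norm_eq_abs] using hq2 ℓ hℓ
      · simpa [Int.norm_eq_abs] using hq3 ℓ hℓ
    have hn0 : 0 < ‖![(q ℓ).re, (q ℓ).im]‖ := by
      rw [norm_pos_iff]
      intro h0
      have h1 : q ℓ = 0 := Zsqrtd.ext (congrFun h0 0) (congrFun h0 1)
      have h2 := hq1 ℓ hℓ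
      rw [h1, map_zero, mul_zero] at h2
      exact (pow_pos hl 2).ne h2
    have h1 : (D * ℓ ^ 2) ^ (-(5 / 2) : ℝ) ≤ ‖![(q ℓ).re, (q ℓ).im]‖ ^ (-(5 / 2) : ℝ) :=
      Real.rpow_le_rpow_of_nonpos hn0 hn (by norm_num)
    calc (ℓ ^ 5)⁻¹ = D ^ (5 / 2 : ℝ) * (D * ℓ ^ 2) ^ (-(5 / 2) : ℝ) := by
          rw [Real.mul_rpow hD.le (by positivity), ← mul_assoc, ← Real.rpow_add hD,
            ← Real.rpow_natCast, ← Real.rpow_natCast, ← Real.rpow_mul hl.le, ← Real.rpow_neg hl.le]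
          norm_num
      _ ≤ _ := by gcongr
  calc ∑ ℓ ∈ T, (ℓ ^ 5)⁻¹
      ≤ ∑ ℓ ∈ T, D ^ (5 / 2 : ℝ) * ‖![(q ℓ).re, (q ℓ).im]‖ ^ (-(5 / 2) : ℝ) :=
        Finset.sum_le_sum hterm
    _ = D ^ (5 / 2 : ℝ) * ∑ x ∈ T.image (fun ℓ => ![(q ℓ).re, (q ℓ).im]),
          ‖x‖ ^ (-(5 / 2) : ℝ) := by
        rw [Finset.sum_image hinj, Finset.mul_sum]
    _ ≤ _ := by
        gcongr
        exact hsum.sum_le_tsum _ fun _ _ => by positivity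

/-! ### Counting sums by a generating function -/

/-- The geometric series is 1 + 1/(exp x - 1) ≤ exp(1/(exp x - 1)), and exp x - 1 ≥ x⁵/5!. -/
theorem sum_range_exp_pow_le {x : ℝ} (hx : 0 < x) (N : ℕ) :
    ∑ j ∈ Finset.range N, Real.exp (-x) ^ j ≤ Real.exp (120 * (x ^ 5)⁻¹) := by
  have h1 : x ^ 5 / 120 ≤ Real.exp x - 1 := by
    have := Real.sum_le_exp_of_nonneg hx.le 6
    simp only [Finset.sum_range_succ, Finset.sum_range_zero, Nat.factorial] at this
    norm_num at this
    have : 0 ≤ x + x ^ 2 / 2 + x ^ 3 / 6 + x ^ 4 / 24 := by positivity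
    linarith
  have h2 : 0 < Real.exp x - 1 := lt_of_lt_of_le (by positivity) h1
  have h3 : Real.exp (-x) < 1 := by rw [Real.exp_lt_one_iff]; linarith
  have h4 : (1 - Real.exp (-x))⁻¹ = (Real.exp x - 1)⁻¹ + 1 := by
    rw [Real.exp_neg]
    have h5 := Real.exp_pos x
    have h6 : 1 - (Real.exp x)⁻¹ = (Real.exp x - 1) / Real.exp x := by field_simp
    rw [h6]; field_simp; ring
  calc ∑ j ∈ Finset.range N, Real.exp (-x) ^ j
      ≤ ∑' j, Real.exp (-x) ^ j :=
        (summable_geometric_of_lt_one (Real.exp_pos _).le h3).sum_le_tsum _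
          fun _ _ => by positivity
    _ = (Real.exp x - 1)⁻¹ + 1 := by rw [tsum_geometric_of_lt_one (Real.exp_pos _).le h3, h4]
    _ ≤ Real.exp ((Real.exp x - 1)⁻¹) := Real.add_one_le_exp _
    _ ≤ _ := by
        rw [Real.exp_le_exp]
        calc (Real.exp x - 1)⁻¹ ≤ (x ^ 5 / 120)⁻¹ := by gcongr
          _ = _ := by rw [inv_div, div_eq_mul_inv]

/-- The generating function of the sums of elements of a set of positive numbers. -/
theorem sum_exp_neg_le {L : Set ℝ} (hL : ∀ ℓ ∈ L, 0 < ℓ) {M : ℝ}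
    (hM : ∀ T : Finset ℝ, (∀ ℓ ∈ T, ℓ ∈ L) → ∑ ℓ ∈ T, (ℓ ^ 5)⁻¹ ≤ M) {s : ℝ} (hs : 0 < s)
    (T : Finset ℝ) (hT : ∀ τ ∈ T, ∃ m : Multiset ℝ, (∀ ℓ ∈ m, ℓ ∈ L) ∧ m.sum = τ) :
    ∑ τ ∈ T, Real.exp (-(s * τ)) ≤ Real.exp (120 * (s ^ 5)⁻¹ * M) := by
  choose! m hm hsum using hT
  set S := T.biUnion fun τ => (m τ).toFinset
  -- One more than the largest chosen multiset, so that every multiplicity lies in `range N`.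
  set N := T.sup (fun τ => Multiset.card (m τ)) + 1
  have hS : ∀ ℓ ∈ S, ℓ ∈ L := by
    intro ℓ hℓ
    simp only [S, Finset.mem_biUnion, Multiset.mem_toFinset] at hℓ
    obtain ⟨τ, hτ, h⟩ := hℓ
    exact hm τ hτ ℓ h
  have hτ : ∀ τ ∈ T, τ = ∑ i : S, (Multiset.count (i : ℝ) (m τ) : ℝ) * i := by
    intro τ h
    have h1 : (m τ).toFinset ⊆ S := Finset.subset_biUnion_of_mem (fun τ => (m τ).toFinset) h
    rw [Finset.sum_coe_sort S fun i => (Multiset.count i (m τ) : ℝ) * i]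
    conv_lhs => rw [← hsum τ h, Finset.sum_multiset_count_of_subset _ _ h1]
    simp [nsmul_eq_mul]
  -- One multiset is chosen for each sum, so its multiplicity function determines the sum. Distinct
  -- sums thus give distinct terms of the expanded product.
  let g : ℝ → S → ℕ := fun τ i => Multiset.count (i : ℝ) (m τ)
  have hg : Set.InjOn g T := by
    intro x hx y hy hxy
    rw [hτ x hx, hτ y hy]
    refine Finset.sum_congr rfl fun i _ => ?_
    have := congrFun hxy i
    simp only [g] at this
    rw [this]
  have hexp : ∀ τ ∈ T, Real.exp (-(s * τ)) = ∏ i : S, Real.exp (-(s * i)) ^ g τ i := by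
    intro τ h
    conv_lhs => rw [hτ τ h, Finset.mul_sum, ← Finset.sum_neg_distrib, Real.exp_sum]
    refine Finset.prod_congr rfl fun i _ => ?_
    rw [← Real.exp_nat_mul]
    congr 1
    simp only [g]
    ring
  calc ∑ τ ∈ T, Real.exp (-(s * τ)) = ∑ τ ∈ T, ∏ i : S, Real.exp (-(s * i)) ^ g τ i :=
        Finset.sum_congr rfl hexp
    _ = ∑ p ∈ T.image g, ∏ i : S, Real.exp (-(s * i)) ^ p i := by rw [Finset.sum_image hg]
    _ ≤ ∑ p ∈ Fintype.piFinset fun _ : S => Finset.range N,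
          ∏ i : S, Real.exp (-(s * i)) ^ p i := by
        apply Finset.sum_le_sum_of_subset_of_nonneg
        · intro p hp
          obtain ⟨τ, h, rfl⟩ := Finset.mem_image.1 hp
          rw [Fintype.mem_piFinset]
          intro i
          rw [Finset.mem_range, Nat.lt_succ_iff]
          exact (Multiset.count_le_card _ _).trans
            (Finset.le_sup (f := fun τ => Multiset.card (m τ)) h)
        · intro _ _ _; positivity
    _ = ∏ i : S, ∑ j ∈ Finset.range N, Real.exp (-(s * i)) ^ j := by rw [Finset.prod_univ_sum]
    _ ≤ ∏ i : S, Real.exp (120 * ((s * i) ^ 5)⁻¹) := by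
        apply Finset.prod_le_prod
        · intro _ _; positivity
        · intro i _
          exact sum_range_exp_pow_le (mul_pos hs (hL _ (hS i i.2))) N
    _ = Real.exp (120 * (s ^ 5)⁻¹ * ∑ i ∈ S, (i ^ 5)⁻¹) := by
        rw [← Real.exp_sum, Finset.sum_coe_sort S fun i => 120 * ((s * i) ^ 5)⁻¹, Finset.mul_sum]
        congr 1
        refine Finset.sum_congr rfl fun i _ => ?_
        rw [mul_pow, mul_inv]; ring
    _ ≤ _ := by
        gcongr
        exact hM S hS

/-- The number of sums of elements of a sparse set of positive numbers. -/
theorem card_sums_le {L : Set ℝ} (hL : ∀ ℓ ∈ L, 0 < ℓ) {M : ℝ}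
    (hM : ∀ T : Finset ℝ, (∀ ℓ ∈ T, ℓ ∈ L) → ∑ ℓ ∈ T, (ℓ ^ 5)⁻¹ ≤ M) {t : ℝ} (ht : 0 < t)
    (T : Finset ℝ) (hT : ∀ τ ∈ T, ∃ m : Multiset ℝ, (∀ ℓ ∈ m, ℓ ∈ L) ∧ m.sum = τ)
    (hTt : ∀ τ ∈ T, τ ≤ t) :
    (T.card : ℝ) ≤ Real.exp ((1 + 120 * M) * t ^ (5 / 6 : ℝ)) := by
  -- This choice makes s·t and s⁻⁵ both equal to t^(5/6).
  set s := t ^ (-(1 / 6) : ℝ)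
  have hs : 0 < s := by positivity
  have h1 : s * t = t ^ (5 / 6 : ℝ) := by
    conv_lhs => rw [← Real.rpow_one t]
    rw [Real.rpow_one, ← Real.rpow_add_one ht.ne']
    norm_num
  have h2 : (s ^ 5)⁻¹ = t ^ (5 / 6 : ℝ) := by
    rw [← Real.rpow_natCast, ← Real.rpow_mul ht.le, ← Real.rpow_neg ht.le]
    norm_num
  have h3 := sum_exp_neg_le hL hM hs T hT
  have h4 : T.card * Real.exp (-(s * t)) ≤ ∑ τ ∈ T, Real.exp (-(s * τ)) := by
    rw [← nsmul_eq_mul]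
    apply Finset.card_nsmul_le_sum
    intro τ hτ
    rw [Real.exp_le_exp, neg_le_neg_iff]
    exact mul_le_mul_of_nonneg_left (hTt τ hτ) hs.le
  have h5 := h4.trans h3
  rw [Real.exp_neg, ← div_eq_mul_inv, div_le_iff₀ (Real.exp_pos _), ← Real.exp_add, h1, h2] at h5
  refine h5.trans_eq ?_
  congr 1
  ring

/-! ### From sums of lengths to waves -/

theorem finite_and_ncard_le_of_forall_card_le {α : Type*} {A : Set α} {B : ℝ}
    (h : ∀ T : Finset α, (T : Set α) ⊆ A → (T.card : ℝ) ≤ B) : A.Finite ∧ (A.ncard : ℝ) ≤ B := by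
  have hf : A.Finite := by
    by_contra hinf
    obtain ⟨T, hT, hc⟩ := Set.Infinite.exists_subset_card_eq hinf (⌊B⌋₊ + 1)
    have := h T hT
    rw [hc] at this
    push_cast at this
    linarith [Nat.lt_floor_add_one B]
  refine ⟨hf, ?_⟩
  rw [Set.ncard_eq_toFinset_card A hf]
  exact h _ (by simp)

/-- Only the lengths used matter for the count; their order and the intermediate vertices are
forgotten. -/
theorem Arrives.exists_multiset {a : ℝ} {S A : E3} {τ : ℝ} (h : Arrives a S A τ) :
    A ∈ vertices a ∧ ∃ m : Multiset ℝ, m ≠ 0 ∧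
      (∀ ℓ ∈ m, ∃ V W, IsGeodesic a V W ℓ) ∧ m.sum = τ := by
  induction h with
  | @direct A ℓ h =>
    exact ⟨h.2.1, {ℓ}, by simp, by simpa using ⟨_, _, h⟩, by simp⟩
  | @next B A τ ℓ _ h ih =>
    obtain ⟨-, m, -, hm, hsum⟩ := ih
    refine ⟨h.2.1, ℓ ::ₘ m, by simp, ?_, by rw [Multiset.sum_cons, hsum, add_comm]⟩
    intro x hx
    rcases Multiset.mem_cons.1 hx with rfl | hx
    · exact ⟨_, _, h⟩
    · exact hm x hx

theorem finite_vertices_and_ncard_le (a : ℝ) :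
    (vertices a).Finite ∧ (vertices a).ncard ≤ 20 := by
  have h : vertices a = (fun k => scale a • stdVertex k) '' Set.univ := by
    ext v
    rw [mem_vertices_iff]
    simp [eq_comm]
  rw [h]
  refine ⟨Set.finite_univ.image _, (Set.ncard_image_le Set.finite_univ).trans ?_⟩
  simp [Set.ncard_univ]

end Dodecahedron

theorem mainTheorem2 (a : ℝ) (ha : 0 < a) :
    ∃ c : ℝ, ∀ S ∈ Dodecahedron.vertices a, ∀ t : ℝ, 0 ≤ t →
      (Dodecahedron.waves a S t).Finite ∧
        ((Dodecahedron.waves a S t).ncard : ℝ) < Real.exp (c * t ^ (5 / 6 : ℝ)) := by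
  obtain ⟨M₀, hM₀⟩ := Dodecahedron.exists_sum_inv_pow_le ha
  set M := max M₀ 1
  have hM1 : 0 < M := lt_of_lt_of_le one_pos (le_max_right _ _)
  set L : Set ℝ := {ℓ | ∃ V W, Dodecahedron.IsGeodesic a V W ℓ}
  have hL : ∀ ℓ ∈ L, 0 < ℓ := by
    rintro ℓ ⟨V, W, h⟩
    exact h.pos ha
  have hM : ∀ T : Finset ℝ, (∀ ℓ ∈ T, ℓ ∈ L) → ∑ ℓ ∈ T, (ℓ ^ 5)⁻¹ ≤ M :=
    fun T hT => (hM₀ T hT).trans (le_max_left _ _)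
  -- A lower bound for t^(5/6) once any wave has arrived, since a single length satisfies ℓ⁻⁵ ≤ M.
  -- The term 20/η in the constant then absorbs the factor 20 for the vertices and makes the
  -- inequality strict.
  set η := (M⁻¹) ^ (1 / 6 : ℝ)
  have hη : 0 < η := by positivity
  refine ⟨1 + 120 * M + 20 / η, fun S _ t ht => ?_⟩
  rcases (Dodecahedron.waves a S t).eq_empty_or_nonempty with h0 | ⟨⟨A, τ⟩, hA, hτ⟩
  · rw [h0]
    exact ⟨Set.finite_empty, by simpa using Real.exp_pos _⟩
  have hmin : M⁻¹ ≤ t ^ 5 := by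
    obtain ⟨-, m, hm0, hm, hsum⟩ := hA.exists_multiset
    change m.sum = τ at hsum
    obtain ⟨ℓ, hℓ⟩ := Multiset.exists_mem_of_ne_zero hm0
    have h1 : ℓ ≤ τ := by
      rw [← hsum]
      exact Multiset.single_le_sum (fun x hx => (hL x (hm x hx)).le) ℓ hℓ
    have h2 := hL ℓ (hm ℓ hℓ)
    have h3 := hM {ℓ} fun x hx => by rw [Finset.mem_singleton.1 hx]; exact hm ℓ hℓ
    rw [Finset.sum_singleton] at h3
    calc M⁻¹ ≤ ℓ ^ 5 := inv_le_of_inv_le₀ (by positivity) h3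
      _ ≤ t ^ 5 := by gcongr; exact h1.trans hτ
  have htpos : 0 < t := by
    rcases ht.eq_or_lt with rfl | h
    · have : 0 < M⁻¹ := by positivity
      norm_num at hmin
      linarith
    · exact h
  have hηt : η ≤ t ^ (5 / 6 : ℝ) := by
    calc η ≤ (t ^ 5) ^ (1 / 6 : ℝ) := Real.rpow_le_rpow (by positivity) hmin (by norm_num)
      _ = _ := by
        rw [← Real.rpow_natCast, ← Real.rpow_mul ht]
        norm_num
  set sums : Set ℝ := {τ | τ ≤ t ∧ ∃ m : Multiset ℝ, (∀ ℓ ∈ m, ℓ ∈ L) ∧ m.sum = τ}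
  obtain ⟨hfin, hcard⟩ := Dodecahedron.finite_and_ncard_le_of_forall_card_le (A := sums)
    fun T hT => Dodecahedron.card_sums_le hL hM htpos T (fun τ h => (hT h).2) fun τ h => (hT h).1
  obtain ⟨vfin, vcard⟩ := Dodecahedron.finite_vertices_and_ncard_le a
  have hsub : Dodecahedron.waves a S t ⊆ Dodecahedron.vertices a ×ˢ sums := by
    rintro ⟨B, σ⟩ ⟨h1, h2⟩
    obtain ⟨hB, m, -, hm, hsum⟩ := h1.exists_multiset
    exact ⟨hB, h2, m, hm, hsum⟩
  have hpfin := vfin.prod hfin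
  refine ⟨hpfin.subset hsub, ?_⟩
  have h20 : (20 : ℝ) < Real.exp (20 / η * t ^ (5 / 6 : ℝ)) := by
    calc (20 : ℝ) < 20 + 1 := by norm_num
      _ ≤ Real.exp 20 := Real.add_one_le_exp 20
      _ ≤ _ := by
        rw [Real.exp_le_exp, div_mul_eq_mul_div, le_div_iff₀ hη]
        gcongr
  calc ((Dodecahedron.waves a S t).ncard : ℝ)
      ≤ ((Dodecahedron.vertices a ×ˢ sums).ncard : ℝ) := by
        exact_mod_cast Set.ncard_le_ncard hsub hpfin
    _ = (Dodecahedron.vertices a).ncard * sums.ncard := by rw [Set.ncard_prod]; push_cast; rfl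
    _ ≤ 20 * Real.exp ((1 + 120 * M) * t ^ (5 / 6 : ℝ)) := by
        gcongr
        exact_mod_cast vcard
    _ < Real.exp (20 / η * t ^ (5 / 6 : ℝ)) * Real.exp ((1 + 120 * M) * t ^ (5 / 6 : ℝ)) := by
        gcongr
    _ = _ := by
        rw [← Real.exp_add]
        congr 1
        ring
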